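/- Let $\mathcal D=\mathbb C[x,\partial]$, $\partial=d/dx$, be the Weyl algebra. For polynomials $P,Q\in\mathbb C[x]$ of degrees $n\ge 1$ and $m\ge 0$, the left module $\mathcal D/\mathcal D\,(P(\partial)+Q(x))$ is called an Airy $\mathcal D$-module of bidegree $(n,m)$. Let $K=\mathbb C((z))$, $z=1/x$, be the field of formal Laurent series at infinity, with the derivation $\partial=d/dx=-z^2\,d/dz$. For a left $\mathcal D$-module $V$, let $\partial$ act on $K\otimes_{\mathbb C[x]}V$ by $\partial(f\otimes v)=\partial f\otimes v+f\otimes\partial v$; if $(e_i)$ is a finite $K$-basis of this space, its first-order linear system is $\partial Y=MY$ with $\partial e_i=\sum_j M_{ij}e_j$. (For $\mathcal D/\mathcal D L$, with $L$ monic of order $n$ in $\partial$, and the classes of $1,\partial,\dots,\partial^{n-1}$, this is the companion system of $L$.) Two $\mathcal D$-modules $V_1,V_2$ are called formally equivalent if, for some $r$, $K\otimes_{\mathbb C[x]} V_1$ and $K\otimes_{\mathbb C[x]} V_2$ have $K$-bases of $r$ elements whose systems $M_1,M_2$ satisfy $$M_2=P^{-1}M_1P-P^{-1}\,\partial P\qquad\text{for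 some } P\in GL(r,K).$$ Proposition. Let $V_1$ and $V_2$ be Airy $\mathcal D$-modules of bidegrees $(n_1,m_1)$ and $(n_2,m_2)$. If $V_1$ and $V_2$ are formally equivalent, then $n_1=n_2$ and $m_1=m_2$. -/

import Mathlib

open Polynomial
open scoped TensorProduct

noncomputable section

namespace Airy

/-! ### The Weyl algebra `ℂ[x, ∂]` -/

/-- The defining relation `∂ x = x ∂ + 1`; the generator `x` is indexed by `false`, `∂` by `true`. -/
inductive WeylRel : FreeAlgebra ℂ Bool → FreeAlgebra ℂ Bool → Prop
  | comm : WeylRel (FreeAlgebra.ι ℂ true * FreeAlgebra.ι ℂ false)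
      (FreeAlgebra.ι ℂ false * FreeAlgebra.ι ℂ true + 1)

/-- The Weyl algebra `ℂ[x, ∂]` of the affine line. -/
def WeylAlgebra : Type := RingQuot WeylRel

namespace WeylAlgebra

instance : Ring WeylAlgebra := inferInstanceAs (Ring (RingQuot WeylRel))

instance : Algebra ℂ WeylAlgebra := inferInstanceAs (Algebra ℂ (RingQuot WeylRel))

/-- The multiplication operator `x`. -/
def x : WeylAlgebra := RingQuot.mkAlgHom ℂ WeylRel (FreeAlgebra.ι ℂ false)

/-- The derivation `∂ = d/dx`. -/
def d : WeylAlgebra := RingQuot.mkAlgHom ℂ WeylRel (FreeAlgebra.ι ℂ true)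

theorem d_mul_x : d * x = x * d + 1 := by
  have h := RingQuot.mkAlgHom_rel ℂ WeylRel.comm
  rw [map_mul, map_add, map_mul, map_one] at h
  exact h

/-- The commutation rule `∂ p(x) = p(x) ∂ + p'(x)`. -/
theorem d_mul_aeval_x (p : ℂ[X]) :
    d * aeval x p = aeval x p * d + aeval x (derivative p) := by
  have hd : ∀ a : ℂ, d * algebraMap ℂ WeylAlgebra a = algebraMap ℂ WeylAlgebra a * d :=
    fun a => (Algebra.commutes a d).symm
  induction p using Polynomial.induction_on with
  | C a => simp [hd]
  | add p q hp hq => simp only [map_add, mul_add, add_mul, hp, hq]; abel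
  | monomial n a ih =>
    have e : (C a * X ^ (n + 1) : ℂ[X]) = C a * X ^ n * X := by ring
    rw [e, derivative_mul, derivative_X, mul_one, map_mul _ (C a * X ^ n) X, map_add,
      map_mul _ (derivative (C a * X ^ n)) X, aeval_X, ← mul_assoc, ih, add_mul, mul_assoc _ d,
      d_mul_x]
    noncomm_ring

end WeylAlgebra

/-- A left module over the Weyl algebra is a `ℂ[x]`-module, `p` acting as `p(x)`. -/
instance (priority := low) polynomialModule (V : Type*) [AddCommGroup V] [Module WeylAlgebra V] :
    Module ℂ[X] V :=
  Module.compHom V (aeval WeylAlgebra.x : ℂ[X] →ₐ[ℂ] WeylAlgebra).toRingHom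

theorem polynomial_smul_def {V : Type*} [AddCommGroup V] [Module WeylAlgebra V] (p : ℂ[X])
    (v : V) : p • v = (aeval WeylAlgebra.x p : WeylAlgebra) • v := rfl

/-! ### Airy operators and Airy modules -/

/-- The operator `P(∂) + Q(x)`. -/
def airyOperator (P Q : ℂ[X]) : WeylAlgebra := aeval WeylAlgebra.d P + aeval WeylAlgebra.x Q

/-- The left module `𝒟 / 𝒟 (P(∂) + Q(x))` over the Weyl algebra `𝒟`. -/
abbrev AiryModule (P Q : ℂ[X]) : Type :=
  WeylAlgebra ⧸ Submodule.span WeylAlgebra {airyOperator P Q}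

/-! ### The formal field at infinity -/

/-- The differential field `K = ℂ((z))`, `z = 1/x`, of formal Laurent series at infinity. -/
def FormalField : Type := LaurentSeries ℂ

namespace FormalField

instance : Field FormalField := inferInstanceAs (Field (LaurentSeries ℂ))

/-- The constants `ℂ ⊆ K`. -/
def constants : ℂ →+* FormalField := (HahnSeries.C : ℂ →+* LaurentSeries ℂ)

instance : Algebra ℂ FormalField := constants.toAlgebra

/-- The local parameter `z = 1/x` at infinity. -/
def z : FormalField := (HahnSeries.single (1 : ℤ) (1 : ℂ) : LaurentSeries ℂ)

/-- `ℂ[x]` embeds in `K` by `x ↦ 1/z`. -/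
instance : Algebra ℂ[X] FormalField :=
  (aeval z⁻¹ : ℂ[X] →ₐ[ℂ] FormalField).toRingHom.toAlgebra

theorem algebraMap_def (p : ℂ[X]) : algebraMap ℂ[X] FormalField p = aeval z⁻¹ p := rfl

/-- The derivation `d/dz` of `ℂ((z))`. -/
def derivZ : FormalField →+ FormalField :=
  (LaurentSeries.derivative ℂ : LaurentSeries ℂ →ₗ[ℂ] LaurentSeries ℂ).toAddMonoidHom

/-- The derivation `∂ = d/dx = -z² d/dz`. -/
def deriv : FormalField →+ FormalField := (AddMonoidHom.mulLeft (-z ^ 2)).comp derivZ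

theorem deriv_apply (f : FormalField) : deriv f = -z ^ 2 * derivZ f := rfl

theorem z_ne_zero : z ≠ 0 :=
  HahnSeries.single_ne_zero (one_ne_zero : (1 : ℂ) ≠ 0)

theorem z_inv : z⁻¹ = (HahnSeries.single (-1 : ℤ) (1 : ℂ) : LaurentSeries ℂ) := by
  refine inv_eq_of_mul_eq_one_left ?_
  exact (HahnSeries.single_mul_single (Γ := ℤ) (R := ℂ)).trans (by simp; rfl)

theorem algebraMap_complex (a : ℂ) :
    algebraMap ℂ FormalField a = (HahnSeries.C a : LaurentSeries ℂ) :=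
  rfl

theorem derivZ_C_mul (a : ℂ) (f : FormalField) :
    derivZ (algebraMap ℂ FormalField a * f) = algebraMap ℂ FormalField a * derivZ f := by
  have h : ∀ g : LaurentSeries ℂ, HahnSeries.C a * g = a • g := fun g => HahnSeries.C_mul_eq_smul
  rw [algebraMap_complex]
  exact ((congrArg (LaurentSeries.derivative ℂ) (h f)).trans
    ((LaurentSeries.derivative ℂ).map_smul a (f : LaurentSeries ℂ))).trans
    (h (LaurentSeries.derivative ℂ (f : LaurentSeries ℂ))).symm

theorem derivZ_z_inv_mul (f : FormalField) :
    derivZ (z⁻¹ * f) = -(z⁻¹ * (z⁻¹ * f)) + z⁻¹ * derivZ f := by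
  have key : ∀ (g : LaurentSeries ℂ) (k : ℤ),
      (HahnSeries.single (-1 : ℤ) (1 : ℂ) * g).coeff k = g.coeff (k + 1) := by
    intro g k
    have h := HahnSeries.coeff_single_mul_add (r := (1 : ℂ)) (x := g) (a := k + 1) (b := (-1 : ℤ))
    simpa using h
  have main : ∀ g : LaurentSeries ℂ,
      LaurentSeries.derivative ℂ (HahnSeries.single (-1 : ℤ) (1 : ℂ) * g) =
        -(HahnSeries.single (-1 : ℤ) (1 : ℂ) * (HahnSeries.single (-1 : ℤ) (1 : ℂ) * g)) +
          HahnSeries.single (-1 : ℤ) (1 : ℂ) * LaurentSeries.derivative ℂ g := by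
    intro g
    ext n
    simp only [LaurentSeries.derivative_apply, LaurentSeries.hasseDeriv_coeff,
      HahnSeries.coeff_add, HahnSeries.coeff_neg, key, Ring.choose_one_right, zsmul_eq_mul]
    push_cast
    ring
  rw [z_inv]
  exact main f

theorem deriv_z_inv_mul (f : FormalField) : deriv (z⁻¹ * f) = f + z⁻¹ * deriv f := by
  have hz := z_ne_zero
  rw [deriv_apply, deriv_apply, derivZ_z_inv_mul]
  field_simp
  ring

/-- The Leibniz rule `∂ (p f) = p' f + p ∂ f` for `p ∈ ℂ[x]`, `f ∈ K`. -/
theorem deriv_polynomial_smul (p : ℂ[X]) (f : FormalField) :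
    deriv (p • f) = derivative p • f + p • deriv f := by
  simp only [Algebra.smul_def, algebraMap_def]
  induction p using Polynomial.induction_on generalizing f with
  | C a =>
    rw [aeval_C, derivative_C, map_zero, zero_mul, zero_add, deriv_apply, deriv_apply,
      derivZ_C_mul]
    ring
  | add p q hp hq => simp only [map_add, add_mul, hp, hq]; ring
  | monomial n a ih =>
    have e : (C a * X ^ (n + 1) : ℂ[X]) = C a * X ^ n * X := by ring
    rw [e, derivative_mul, derivative_X, mul_one, map_mul _ (C a * X ^ n) X, map_add,
      map_mul _ (derivative (C a * X ^ n)) X, aeval_X, mul_assoc _ z⁻¹ f, ih, deriv_z_inv_mul]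
    ring

end FormalField

/-! ### Formal equivalence at infinity -/

section

variable (V : Type*) [AddCommGroup V] [Module WeylAlgebra V]

/-- The formalization at infinity `K ⊗_{ℂ[x]} V` of a left module over the Weyl algebra. -/
abbrev Formalization : Type _ := FormalField ⊗[ℂ[X]] V

/-- The biadditive map `(f, v) ↦ (∂ f) ⊗ v + f ⊗ (∂ v)`. -/
def connectionAux : FormalField →+ V →+ Formalization V where
  toFun f :=
    { toFun := fun v => FormalField.deriv f ⊗ₜ[ℂ[X]] v + f ⊗ₜ[ℂ[X]] (WeylAlgebra.d • v)
      map_zero' := by simp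
      map_add' := fun v w => by simp only [smul_add, TensorProduct.tmul_add]; abel }
  map_zero' := by ext v; simp
  map_add' f g := by
    ext v
    simp only [map_add, TensorProduct.add_tmul, AddMonoidHom.coe_mk, ZeroHom.coe_mk,
      AddMonoidHom.add_apply]
    abel

/-- The connection `∂ (f ⊗ v) = (∂ f) ⊗ v + f ⊗ (∂ v)` on the formalization of `V`. -/
def connection : Formalization V →+ Formalization V :=
  TensorProduct.liftAddHom (connectionAux V) (by
    intro p f v
    have h : WeylAlgebra.d • (p • v) = p • (WeylAlgebra.d • v) + derivative p • v := by
      simp only [polynomial_smul_def, smul_smul, WeylAlgebra.d_mul_aeval_x, add_smul]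
    change FormalField.deriv (p • f) ⊗ₜ[ℂ[X]] v + (p • f) ⊗ₜ[ℂ[X]] (WeylAlgebra.d • v) =
      FormalField.deriv f ⊗ₜ[ℂ[X]] (p • v) + f ⊗ₜ[ℂ[X]] (WeylAlgebra.d • (p • v))
    rw [h, FormalField.deriv_polynomial_smul, TensorProduct.add_tmul, TensorProduct.tmul_add,
      TensorProduct.smul_tmul, TensorProduct.smul_tmul, TensorProduct.smul_tmul]
    abel)

end

/-- The matrix `M` of the first order system `∂ Y = M Y` attached to `V` and to a basis
`(e i)` of its formalization: `∂ (e i) = ∑ j, M i j • e j`.  For `V = 𝒟 / 𝒟 L`, `L` monic of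
order `n` in `∂`, and the classes of `1, ∂, …, ∂ ^ (n - 1)`, it is the companion matrix of `L`,
with `Y = (y, ∂ y, …, ∂ ^ (n - 1) y)` for a solution `y` of `L y = 0`. -/
def systemMatrix {V : Type*} [AddCommGroup V] [Module WeylAlgebra V] {n : ℕ}
    (b : Module.Basis (Fin n) FormalField (Formalization V)) :
    Matrix (Fin n) (Fin n) FormalField :=
  Matrix.of fun i j => b.repr (connection V (b i)) j

/-- Gauge equivalence over `K`: `M₂ = P⁻¹ M₁ P - P⁻¹ ∂ P` for some `P ∈ GL(n, K)`. -/
def GaugeEquivalent {n : ℕ} (M₁ M₂ : Matrix (Fin n) (Fin n) FormalField) : Prop :=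
  ∃ P : GL (Fin n) FormalField,
    M₂ = (P⁻¹).val * M₁ * P.val - (P⁻¹).val * P.val.map FormalField.deriv

/-- `V₁` and `V₂` are formally equivalent (at infinity): their formalizations have bases of the
same finite cardinality, and the first order systems attached to these are gauge equivalent
over `K`. -/
def FormallyEquivalent (V₁ V₂ : Type*) [AddCommGroup V₁] [Module WeylAlgebra V₁]
    [AddCommGroup V₂] [Module WeylAlgebra V₂] : Prop :=
  ∃ (n : ℕ) (b₁ : Module.Basis (Fin n) FormalField (Formalization V₁))
    (b₂ : Module.Basis (Fin n) FormalField (Formalization V₂)),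
    GaugeEquivalent (systemMatrix b₁) (systemMatrix b₂)

end Airy

end

/-! Over `K` an Airy module has the basis `u, ∂u, …, ∂^(n-1) u`, where `u` is the class of 1. Its
rank is therefore `n`, and a gauge equivalence, being a `K`-linear isomorphism that commutes with
`∂`, forces `n₁ = n₂`.

The degree `m` is recovered from growth: since `P(∂) u = -Q u`, the operator `∂` behaves like
`x^(m/n)`. To make this precise, give `z^j ∂^i u` the weight `n*j - i*m`. Then `∂` lowers weights by
at most `m` (`connection_mem_filtration`), so `P₁(∂)` with `deg P₁ = n` lowers them by at most
`n*m`, whereas multiplication by `Q₁` lowers them by exactly `n * deg Q₁`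
(`mem_filtration_of_polynomial_smul_mem`). If `Q₁ v = -P₁(∂) v` and `deg Q₁ > m`, the weight of `v`
can be raised indefinitely, so `v = 0` (`natDegree_le_of_annihilates`). Transporting the generator
of either module into the other gives both inequalities between the degrees. -/

noncomputable section

namespace Airy

/-! ### Coefficients, derivation and orders of Laurent series -/

namespace FormalField

/-- The coefficient of `z ^ j`. -/
def coeff (f : FormalField) (j : ℤ) : ℂ := HahnSeries.coeff (f : LaurentSeries ℂ) j

theorem ext_coeff {f g : FormalField} (h : ∀ j, coeff f j = coeff g j) : f = g :=
  HahnSeries.ext (funext h)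

theorem coeff_zero (j : ℤ) : coeff 0 j = 0 := rfl

theorem coeff_add (f g : FormalField) (j : ℤ) : coeff (f + g) j = coeff f j + coeff g j := rfl

theorem coeff_neg (f : FormalField) (j : ℤ) : coeff (-f) j = -coeff f j := rfl

theorem coeff_algebraMap_mul (a : ℂ) (f : FormalField) (j : ℤ) :
    coeff (algebraMap ℂ FormalField a * f) j = a * coeff f j :=
  HahnSeries.coeff_single_zero_mul (Γ := ℤ) (r := a) (x := (f : LaurentSeries ℂ)) (a := j)

theorem coeff_z_mul (f : FormalField) (j : ℤ) : coeff (z * f) j = coeff f (j - 1) := by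
  have h := HahnSeries.coeff_single_mul_add (r := (1 : ℂ)) (x := (f : LaurentSeries ℂ))
    (a := j - 1) (b := (1 : ℤ))
  rw [sub_add_cancel, one_mul] at h
  exact h

theorem coeff_z_inv_mul (f : FormalField) (j : ℤ) : coeff (z⁻¹ * f) j = coeff f (j + 1) := by
  have h := coeff_z_mul (z⁻¹ * f) (j + 1)
  rw [mul_inv_cancel_left₀ z_ne_zero, add_sub_cancel_right] at h
  exact h.symm

theorem coeff_z_inv_pow_mul (a : ℕ) (f : FormalField) (j : ℤ) :
    coeff (z⁻¹ ^ a * f) j = coeff f (j + a) := by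
  induction a generalizing j with
  | zero => simp
  | succ a ih => rw [pow_succ', mul_assoc, coeff_z_inv_mul, ih, Nat.cast_succ, add_assoc, add_comm 1 (a : ℤ)]

theorem coeff_derivZ (f : FormalField) (j : ℤ) :
    coeff (derivZ f) j = (j + 1) * coeff f (j + 1) := by
  have h : ∀ g : LaurentSeries ℂ,
      (LaurentSeries.derivative ℂ g).coeff j = (j + 1) * g.coeff (j + 1) := fun g => by
    rw [LaurentSeries.derivative_apply, LaurentSeries.hasseDeriv_coeff, Nat.cast_one,
      Ring.choose_one_right, zsmul_eq_mul]
    push_cast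
    rfl
  exact h f

theorem coeff_deriv (f : FormalField) (j : ℤ) :
    coeff (deriv f) j = -((j - 1) * coeff f (j - 1)) := by
  rw [deriv_apply, neg_mul, coeff_neg, pow_two, mul_assoc, coeff_z_mul, coeff_z_mul, coeff_derivZ]
  push_cast
  rw [sub_add_cancel, sub_add_cancel]

/-- Enlarging the supports gives several products a common index set, so that the Leibniz rule can
be compared term by term. -/
theorem coeff_mul_of_support_subset {f g : FormalField} {s t : Set ℤ} (hs : s.IsPWO)
    (ht : t.IsPWO) (hf : Function.support (coeff f) ⊆ s) (hg : Function.support (coeff g) ⊆ t)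
    (j : ℤ) :
    coeff (f * g) j = ∑ p ∈ Finset.antidiagonal hs ht j, coeff f p.1 * coeff g p.2 := by
  have h := HahnSeries.coeff_mul (x := (f : LaurentSeries ℂ)) (y := (g : LaurentSeries ℂ)) (a := j)
  refine h.trans ?_
  refine Finset.sum_subset (fun p hp => ?_) (fun p hp hn => ?_)
  · rw [Finset.mem_antidiagonal] at hp ⊢
    exact ⟨hf hp.1, hg hp.2.1, hp.2.2⟩
  · rw [Finset.mem_antidiagonal] at hp hn
    by_contra h
    exact hn ⟨left_ne_zero_of_mul h, right_ne_zero_of_mul h, hp.2.2⟩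

theorem deriv_mul (f g : FormalField) : deriv (f * g) = deriv f * g + f * deriv g := by
  have hz := z_ne_zero
  -- The Euler operator `x ∂ = -z d/dz` is diagonal on powers of `z`; for it the Leibniz rule is
  -- just additivity of exponents.
  have hθ : ∀ (h : FormalField) (j : ℤ), coeff (z⁻¹ * deriv h) j = -(j * coeff h j) := by
    intro h j
    rw [coeff_z_inv_mul, coeff_deriv]
    push_cast
    rw [add_sub_cancel_right, add_sub_cancel_right]
  have hsupp : ∀ h : FormalField,
      Function.support (coeff (z⁻¹ * deriv h)) ⊆ Function.support (coeff h) := by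
    intro h j hj hz
    exact hj (by simp [hθ, hz])
  have hpwo : ∀ h : FormalField, (Function.support (coeff h)).IsPWO :=
    fun h => HahnSeries.isPWO_support (h : LaurentSeries ℂ)
  have key : z⁻¹ * deriv (f * g) = (z⁻¹ * deriv f) * g + f * (z⁻¹ * deriv g) := by
    refine ext_coeff fun j => ?_
    rw [hθ, coeff_add, coeff_mul_of_support_subset (hpwo f) (hpwo g) subset_rfl subset_rfl,
      coeff_mul_of_support_subset (hpwo f) (hpwo g) (hsupp f) subset_rfl,
      coeff_mul_of_support_subset (hpwo f) (hpwo g) subset_rfl (hsupp g),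
      ← Finset.sum_add_distrib, Finset.mul_sum, ← Finset.sum_neg_distrib]
    refine Finset.sum_congr rfl fun p hp => ?_
    rw [Finset.mem_antidiagonal] at hp
    rw [hθ, hθ, ← hp.2.2]
    push_cast
    ring
  have := congrArg (z * ·) key
  simp only [mul_add] at this
  rw [mul_inv_cancel_left₀ hz] at this
  rw [this]
  field_simp

theorem deriv_one : deriv 1 = 0 := by
  have h := deriv_mul 1 1
  simpa using h

theorem deriv_algebraMap (a : ℂ) : deriv (algebraMap ℂ FormalField a) = 0 := by
  have h := derivZ_C_mul a 1
  have h1 : derivZ 1 = 0 := by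
    have := deriv_one
    rw [deriv_apply] at this
    exact (mul_eq_zero.1 this).resolve_left (neg_ne_zero.2 (pow_ne_zero 2 z_ne_zero))
  rw [deriv_apply, ← mul_one (algebraMap ℂ FormalField a), h, h1]
  simp

theorem coeff_polynomial_mul (q : ℂ[X]) (f : FormalField) (j : ℤ) :
    coeff (algebraMap ℂ[X] FormalField q * f) j =
      ∑ a ∈ Finset.range (q.natDegree + 1), q.coeff a * coeff f (j + a) := by
  have hsum : ∀ (s : Finset ℕ) (F : ℕ → FormalField),
      coeff (∑ a ∈ s, F a) j = ∑ a ∈ s, coeff (F a) j := by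
    intro s F
    classical
    induction s using Finset.induction_on with
    | empty => rfl
    | insert a s ha ih => rw [Finset.sum_insert ha, Finset.sum_insert ha, coeff_add, ih]
  rw [algebraMap_def, aeval_eq_sum_range, Finset.sum_mul, hsum]
  refine Finset.sum_congr rfl fun a _ => ?_
  rw [Algebra.smul_def, mul_assoc, coeff_algebraMap_mul, coeff_z_inv_pow_mul]

theorem exists_coeff_eq_zero (f : FormalField) : ∃ N : ℤ, ∀ j < N, coeff f j = 0 :=
  ⟨HahnSeries.order (f : LaurentSeries ℂ), fun _ hj => HahnSeries.coeff_eq_zero_of_lt_order hj⟩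

theorem exists_leading_coeff {f : FormalField} (hf : f ≠ 0) :
    ∃ N : ℤ, coeff f N ≠ 0 ∧ ∀ j < N, coeff f j = 0 :=
  ⟨HahnSeries.order (f : LaurentSeries ℂ), HahnSeries.coeff_order_eq_zero.not.2 hf,
    fun _ hj => HahnSeries.coeff_eq_zero_of_lt_order hj⟩

/-- Multiplication by a polynomial of degree `m` lowers the order in `z` by exactly `m`. -/
theorem coeff_eq_zero_of_polynomial_mul {q : ℂ[X]} (hq : q ≠ 0) {f : FormalField} {N : ℤ}
    (h : ∀ j < N - q.natDegree, coeff (algebraMap ℂ[X] FormalField q * f) j = 0) :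
    ∀ j < N, coeff f j = 0 := by
  by_cases hf : f = 0
  · intro j _
    rw [hf, coeff_zero]
  obtain ⟨M, hM, hlt⟩ := exists_leading_coeff hf
  suffices N ≤ M from fun j hj => hlt j (hj.trans_le this)
  by_contra! hMN
  -- With `M` the order of `f`, this coefficient of `q f` is the product of the two leading
  -- coefficients.
  have h' := h (M - q.natDegree) (by omega)
  rw [coeff_polynomial_mul, Finset.sum_range_succ, Finset.sum_eq_zero, zero_add,
    sub_add_cancel] at h'
  · exact mul_ne_zero (leadingCoeff_ne_zero.2 hq) hM h'
  · intro a ha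
    rw [Finset.mem_range] at ha
    rw [hlt _ (by omega), mul_zero]

end FormalField

/-! ### The weighted filtration and the comparison of slopes -/

section Filtration

variable {E : Type*} [AddCommGroup E] [Module FormalField E]

/-- The action of `P(∂)` on a vector, for an additive operator `D` in the role of `∂`. -/
def evalConnection (D : E →+ E) (P : ℂ[X]) (u : E) : E :=
  ∑ i ∈ Finset.range (P.natDegree + 1), algebraMap ℂ FormalField (P.coeff i) • D^[i] u

/-- The weighted `z`-adic filtration of a vector space over `K` with a basis `e₀, …, e_{n-1}`, in
which `n * ord z = n` and the weight of `e i` is `-i * m`. -/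
def filtration {n : ℕ} (B : Module.Basis (Fin n) FormalField E) (m : ℕ) (k : ℤ) :
    AddSubgroup E where
  -- Only terms `z^j e_i` of weight `n*j - i*m ≥ k` occur; the factor `n` clears the denominator of
  -- the slope `m/n`.
  carrier := {w | ∀ (i : Fin n) (j : ℤ), n * j < k + i * m → (B.repr w i).coeff j = 0}
  zero_mem' := fun i j _ => by
    rw [map_zero, Finsupp.zero_apply, FormalField.coeff_zero]
  add_mem' := fun {v w} hv hw i j h => by
    rw [map_add, Finsupp.add_apply, FormalField.coeff_add, hv i j h, hw i j h, add_zero]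
  neg_mem' := fun {v} hv i j h => by
    rw [map_neg, Finsupp.neg_apply, FormalField.coeff_neg, hv i j h, neg_zero]

variable {n : ℕ} (B : Module.Basis (Fin n) FormalField E) (m : ℕ)

theorem filtration_antitone : Antitone (filtration B m) :=
  fun _ _ h _ hw i j hj => hw i j (by linarith)

theorem smul_basis_mem_filtration {k : ℤ} {f : FormalField} {i : Fin n}
    (h : ∀ j : ℤ, n * j < k + i * m → f.coeff j = 0) : f • B i ∈ filtration B m k := by
  intro i' j hj
  rw [map_smul, B.repr_self, Finsupp.smul_single, smul_eq_mul, mul_one]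
  by_cases hi : i = i'
  · subst hi
    rw [Finsupp.single_eq_same, h j hj]
  · rw [Finsupp.single_eq_of_ne (Ne.symm hi), FormalField.coeff_zero]

theorem algebraMap_smul_mem_filtration {k : ℤ} (a : ℂ) {w : E} (hw : w ∈ filtration B m k) :
    algebraMap ℂ FormalField a • w ∈ filtration B m k := by
  intro i j hj
  rw [map_smul, Finsupp.smul_apply, smul_eq_mul, FormalField.coeff_algebraMap_mul, hw i j hj,
    mul_zero]

theorem exists_mem_filtration (v : E) : ∃ k, v ∈ filtration B m k := by
  choose N hN using fun i => FormalField.exists_coeff_eq_zero (B.repr v i)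
  have h : ∀ i, ∀ᶠ k : ℤ in Filter.atBot, k + i * m ≤ n * N i := fun i => by
    filter_upwards [Filter.eventually_le_atBot (n * N i - i * m : ℤ)] with k hk
    linarith
  obtain ⟨k, hk⟩ := (Filter.eventually_all.2 h).exists
  refine ⟨k, fun i j hj => hN i j ?_⟩
  exact lt_of_mul_lt_mul_left (hj.trans_le (hk i)) (Int.natCast_nonneg n)

theorem eq_zero_of_forall_mem_filtration {v : E}
    (h : ∀ k, v ∈ filtration B m k) : v = 0 := by
  refine B.repr.map_eq_zero_iff.1 (Finsupp.ext fun i => FormalField.ext_coeff fun j => ?_)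
  -- Level `n*j + 1` already kills the coefficient of `z^j`, because `i*m ≥ 0`.
  exact h (n * j + 1) i j (by have : (0 : ℤ) ≤ i * m := by positivity
                              omega)

/-- Multiplication by `q` lowers every coordinate's order by exactly `deg q`, so the loss of weight
can be undone. -/
theorem mem_filtration_of_polynomial_smul_mem {q : ℂ[X]} (hq : q ≠ 0) {k : ℤ} {w : E}
    (h : algebraMap ℂ[X] FormalField q • w ∈ filtration B m (k - n * q.natDegree)) :
    w ∈ filtration B m k := by
  intro i j hj
  refine FormalField.coeff_eq_zero_of_polynomial_mul hq (N := j + 1) (fun j' hj' => ?_) j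
    (lt_add_one j)
  have := h i j' (by nlinarith)
  rwa [map_smul, Finsupp.smul_apply, smul_eq_mul] at this

/-- The connection lowers the weight by at most the slope. -/
theorem connection_mem_filtration {D : E →+ E}
    (hD : ∀ (f : FormalField) (w : E), D (f • w) = FormalField.deriv f • w + f • D w)
    (hn : 0 < n) (hB : ∀ i : Fin n, B i = D^[i] (B ⟨0, hn⟩)) {P Q : ℂ[X]}
    (hP : P.natDegree = n) (hQ : Q.natDegree = m)
    (hu : evalConnection D P (B ⟨0, hn⟩) + algebraMap ℂ[X] FormalField Q • B ⟨0, hn⟩ = 0)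
    {k : ℤ} {w : E} (hw : w ∈ filtration B m k) : D w ∈ filtration B m (k - m) := by
  have hm : (0 : ℤ) ≤ m := Int.natCast_nonneg m
  rw [← B.sum_repr w, map_sum]
  refine sum_mem fun i _ => ?_
  rw [hD]
  have hi := hw i
  refine add_mem (smul_basis_mem_filtration B m fun j hj => ?_) ?_
  -- Differentiating a coefficient raises its order in `z`, so this term loses no weight.
  · rw [FormalField.coeff_deriv, hi _ (by nlinarith), mul_zero, neg_zero]
  by_cases hlast : (i : ℕ) + 1 < n
  · have e : D (B i) = B ⟨i + 1, hlast⟩ := by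
      rw [hB i, hB ⟨i + 1, hlast⟩, ← Function.iterate_succ_apply' D]
    rw [e]
    refine smul_basis_mem_filtration B m fun j hj => hi j ?_
    push_cast at hj
    linarith
  have hin : (i : ℕ) + 1 = n := by omega
  have hlc : P.coeff n ≠ 0 := by
    rw [← hP]
    exact leadingCoeff_ne_zero.2 (by rintro rfl; simp at hP; omega)
  -- For the last basis vector, the equation satisfied by `e₀` is solved for `∂^n e₀`.
  have e : D (B i) = algebraMap ℂ FormalField (P.coeff n)⁻¹ •
      -(∑ l : Fin n, algebraMap ℂ FormalField (P.coeff l) • B l +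
        algebraMap ℂ[X] FormalField Q • B ⟨0, hn⟩) := by
    rw [evalConnection, hP, Finset.sum_range_succ, Finset.sum_range
      (fun i => algebraMap ℂ FormalField (P.coeff i) • D^[i] (B ⟨0, hn⟩))] at hu
    simp only [← hB] at hu
    have e' : D (B i) = D^[n] (B ⟨0, hn⟩) := by
      rw [hB i, ← Function.iterate_succ_apply' D, Nat.succ_eq_add_one, hin]
    rw [e', map_inv₀, eq_inv_smul_iff₀ (by simpa using hlc), eq_neg_iff_add_eq_zero, ← hu]
    abel
  rw [e, smul_comm]
  refine algebraMap_smul_mem_filtration B m _ ?_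
  rw [smul_neg, smul_add, Finset.smul_sum]
  have hiz : (i : ℤ) = n - 1 := by omega
  refine neg_mem (add_mem (sum_mem fun l _ => ?_) ?_)
  · rw [smul_comm]
    refine algebraMap_smul_mem_filtration B m _ (smul_basis_mem_filtration B m fun j hj => hi j ?_)
    have hl : (l : ℤ) ≤ i := by have := l.2; omega
    nlinarith
  -- The weights are chosen for this term: `Q e₀` has weight `-n*m`, which is the weight `-(n-1)*m`
  -- of `e_(n-1)` lowered by `m`.
  · rw [smul_smul, mul_comm]
    refine smul_basis_mem_filtration B m fun j hj => ?_
    rw [FormalField.coeff_polynomial_mul]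
    refine Finset.sum_eq_zero fun a ha => ?_
    rw [hQ, Finset.mem_range, Nat.lt_succ_iff] at ha
    have ha' : (a : ℤ) ≤ m := by exact_mod_cast ha
    rw [hi _ _, mul_zero]
    rw [hiz]
    simp only [Nat.cast_zero, zero_mul, add_zero] at hj
    nlinarith [mul_le_mul_of_nonneg_left ha' (Int.natCast_nonneg n)]

/-- If `deg Q₁ > m`, dividing `Q₁ v = -P₁(D) v` by `Q₁` gains more weight than `P₁(D)` loses. The
filtration is exhaustive and separated, so `v` would vanish. -/
theorem natDegree_le_of_annihilates {D : E →+ E}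
    (hD : ∀ (f : FormalField) (w : E), D (f • w) = FormalField.deriv f • w + f • D w)
    (hn : 0 < n) (hB : ∀ i : Fin n, B i = D^[i] (B ⟨0, hn⟩)) {P Q : ℂ[X]}
    (hP : P.natDegree = n)
    (hu : evalConnection D P (B ⟨0, hn⟩) + algebraMap ℂ[X] FormalField Q • B ⟨0, hn⟩ = 0)
    {P₁ Q₁ : ℂ[X]} (hP₁ : P₁.natDegree = n) (hQ₁ : Q₁ ≠ 0) {v : E} (hv : v ≠ 0)
    (hv₁ : evalConnection D P₁ v + algebraMap ℂ[X] FormalField Q₁ • v = 0) :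
    Q₁.natDegree ≤ Q.natDegree := by
  set m := Q.natDegree with hm
  have hiter : ∀ (i : ℕ) {k : ℤ} {w : E}, w ∈ filtration B m k →
      D^[i] w ∈ filtration B m (k - i * m) := by
    intro i
    induction i with
    | zero => intro k w hw; simpa using hw
    | succ i ih =>
      intro k w hw
      rw [Function.iterate_succ_apply']
      refine filtration_antitone B m (le_of_eq ?_)
        (connection_mem_filtration B m hD hn hB hP hm.symm hu (ih hw))
      push_cast
      ring
  by_contra! hlt
  refine hv (eq_zero_of_forall_mem_filtration B m ?_)
  have step : ∀ k, v ∈ filtration B m k → v ∈ filtration B m (k + 1) := by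
    intro k hk
    refine mem_filtration_of_polynomial_smul_mem B m hQ₁ ?_
    rw [add_comm, add_eq_zero_iff_eq_neg] at hv₁
    rw [hv₁]
    refine neg_mem (sum_mem fun i hi => algebraMap_smul_mem_filtration B m _
      (filtration_antitone B m ?_ (hiter i hk)))
    rw [Finset.mem_range, hP₁, Nat.lt_succ_iff] at hi
    -- The net gain is at least `n * (deg Q₁ - m) ≥ n ≥ 1`.
    have h₁ : (i : ℤ) * m ≤ n * m := by exact_mod_cast Nat.mul_le_mul_right m hi
    have h₂ : (n : ℤ) * (m + 1) ≤ n * Q₁.natDegree := by exact_mod_cast Nat.mul_le_mul_left n hlt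
    have h₃ : (1 : ℤ) ≤ n := by exact_mod_cast hn
    linarith
  obtain ⟨k₀, hk₀⟩ := exists_mem_filtration B m v
  intro k
  have hall : ∀ a : ℕ, v ∈ filtration B m (k₀ + a) := by
    intro a
    induction a with
    | zero => simpa using hk₀
    | succ a ih => simpa [add_assoc] using step _ ih
  exact filtration_antitone B m (by omega) (hall (k - k₀).toNat)

end Filtration

/-! ### Induction and universal property for the Weyl algebra -/

namespace WeylAlgebra

theorem induction_on {p : WeylAlgebra → Prop} (hC : ∀ a : ℂ, p (algebraMap ℂ WeylAlgebra a))
    (hx : p x) (hd : p d) (hadd : ∀ a b, p a → p b → p (a + b))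
    (hmul : ∀ a b, p a → p b → p (a * b)) (a : WeylAlgebra) : p a := by
  obtain ⟨a, rfl⟩ := RingQuot.mkAlgHom_surjective ℂ WeylRel a
  induction a using FreeAlgebra.induction with
  | grade0 r =>
    rw [AlgHom.commutes]
    exact hC r
  | grade1 b => cases b; exacts [hx, hd]
  | mul a b ha hb =>
    rw [map_mul]
    exact hmul _ _ ha hb
  | add a b ha hb =>
    rw [map_add]
    exact hadd _ _ ha hb

/-- The universal property of the Weyl algebra. -/
def lift {A : Type*} [Ring A] [Algebra ℂ A] (X D : A) (h : D * X = X * D + 1) :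
    WeylAlgebra →ₐ[ℂ] A :=
  RingQuot.liftAlgHom ℂ ⟨FreeAlgebra.lift ℂ fun b => cond b D X, by
    rintro _ _ ⟨⟩
    simpa using h⟩

theorem lift_x {A : Type*} [Ring A] [Algebra ℂ A] (X D : A) (h : D * X = X * D + 1) :
    lift X D h x = X := by
  refine (RingQuot.liftAlgHom_mkAlgHom_apply ℂ _ _ _).trans ?_
  simp

theorem lift_d {A : Type*} [Ring A] [Algebra ℂ A] (X D : A) (h : D * X = X * D + 1) :
    lift X D h d = D := by
  refine (RingQuot.liftAlgHom_mkAlgHom_apply ℂ _ _ _).trans ?_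
  simp

end WeylAlgebra

/-! ### The connection on the formalization -/

section Formalization

variable {V : Type*} [AddCommGroup V] [Module WeylAlgebra V]

theorem connection_tmul (f : FormalField) (v : V) :
    connection V (f ⊗ₜ v) = FormalField.deriv f ⊗ₜ v + f ⊗ₜ (WeylAlgebra.d • v) := rfl

theorem connection_smul (f : FormalField) (w : Formalization V) :
    connection V (f • w) = FormalField.deriv f • w + f • connection V w := by
  induction w using TensorProduct.induction_on with
  | zero => simp
  | tmul g v =>
    simp only [TensorProduct.smul_tmul', smul_eq_mul, connection_tmul, FormalField.deriv_mul,
      TensorProduct.add_tmul, smul_add, add_assoc]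
  | add v w hv hw =>
    rw [smul_add, map_add, hv, hw, map_add, smul_add, smul_add]
    abel

theorem connection_iterate_one_tmul (i : ℕ) (v : V) :
    (connection V)^[i] (1 ⊗ₜ v) = 1 ⊗ₜ (WeylAlgebra.d ^ i • v) := by
  induction i with
  | zero => simp
  | succ i ih =>
    rw [Function.iterate_succ_apply', ih, connection_tmul, FormalField.deriv_one,
      TensorProduct.zero_tmul, zero_add, smul_smul, ← pow_succ']

theorem algebraMap_smul_one_tmul (q : ℂ[X]) (v : V) :
    algebraMap ℂ[X] FormalField q • ((1 : FormalField) ⊗ₜ[ℂ[X]] v) =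
      1 ⊗ₜ ((aeval WeylAlgebra.x q : WeylAlgebra) • v) := by
  rw [← polynomial_smul_def, ← TensorProduct.smul_tmul, TensorProduct.smul_tmul', smul_eq_mul,
    Algebra.smul_def]

theorem constant_smul_one_tmul (a : ℂ) (v : V) :
    algebraMap ℂ FormalField a • ((1 : FormalField) ⊗ₜ[ℂ[X]] v) =
      1 ⊗ₜ (algebraMap ℂ WeylAlgebra a • v) := by
  have h := algebraMap_smul_one_tmul (C a) v
  rwa [FormalField.algebraMap_def, aeval_C, aeval_C] at h

theorem evalConnection_one_tmul (P : ℂ[X]) (v : V) :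
    evalConnection (connection V) P (1 ⊗ₜ v) =
      1 ⊗ₜ ((aeval WeylAlgebra.d P : WeylAlgebra) • v) := by
  rw [evalConnection, aeval_eq_sum_range, Finset.sum_smul, TensorProduct.tmul_sum]
  refine Finset.sum_congr rfl fun i _ => ?_
  rw [connection_iterate_one_tmul, constant_smul_one_tmul, smul_smul, Algebra.smul_def]

/-- A map of `𝒟`-modules from `V` to a vector space over `K` on which `ℂ[x]` acts through `K`
extends to the formalization of `V`. -/
def liftFormalization {W : Type*} [AddCommGroup W] [Module FormalField W] [Module WeylAlgebra W]
    (hx : ∀ (p : ℂ[X]) (w : W), (aeval WeylAlgebra.x p : WeylAlgebra) • w =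
      algebraMap ℂ[X] FormalField p • w) (f : V →ₗ[WeylAlgebra] W) :
    Formalization V →ₗ[FormalField] W :=
  haveI : IsScalarTower ℂ[X] FormalField W := ⟨fun p g w => by
    rw [polynomial_smul_def, hx, Algebra.smul_def, mul_smul]⟩
  LinearMap.liftBaseChange FormalField
    { toFun := f
      map_add' := f.map_add
      map_smul' := fun p v => f.map_smul (aeval WeylAlgebra.x p) v }

theorem liftFormalization_tmul {W : Type*} [AddCommGroup W] [Module FormalField W]
    [Module WeylAlgebra W] (hx : ∀ (p : ℂ[X]) (w : W), (aeval WeylAlgebra.x p : WeylAlgebra) • w =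
      algebraMap ℂ[X] FormalField p • w) (f : V →ₗ[WeylAlgebra] W) (g : FormalField) (v : V) :
    liftFormalization hx f (g ⊗ₜ v) = g • f v := by
  rw [liftFormalization, LinearMap.liftBaseChange_tmul]
  rfl

end Formalization

/-! ### The companion connection on `Kⁿ` -/

section Companion

variable {n : ℕ}

/-- The operator `∂` on `Kⁿ` that sends the `i`-th basis vector to `c i`. -/
def coordinateConnection (c : Fin n → Fin n → FormalField) :
    Module.End ℂ (Fin n → FormalField) where
  toFun w := (fun j => FormalField.deriv (w j)) + ∑ i, w i • c i
  map_add' v w := by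
    simp only [Pi.add_apply, map_add, add_smul, Finset.sum_add_distrib]
    ext j
    simp only [Pi.add_apply]
    abel
  map_smul' a w := by
    ext j
    simp [Algebra.smul_def, FormalField.deriv_mul, FormalField.deriv_algebraMap, mul_add,
      Finset.mul_sum, mul_assoc]

theorem coordinateConnection_apply (c : Fin n → Fin n → FormalField) (w : Fin n → FormalField) :
    coordinateConnection c w = (fun j => FormalField.deriv (w j)) + ∑ i, w i • c i := rfl

theorem coordinateConnection_single (c : Fin n → Fin n → FormalField) (i : Fin n) :
    coordinateConnection c (Pi.single i 1) = c i := by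
  rw [coordinateConnection_apply, Finset.sum_eq_single i]
  · have h : (fun j => FormalField.deriv ((Pi.single i 1 : Fin n → FormalField) j)) = 0 := by
      ext j
      by_cases hj : j = i
      · subst hj
        simp [FormalField.deriv_one]
      · simp [hj]
    rw [h, zero_add, Pi.single_eq_same, one_smul]
  · intro j _ hj
    rw [Pi.single_eq_of_ne hj, zero_smul]
  · simp

/-- Multiplication by `x = 1 / z` on `Kⁿ`. -/
def mulX (n : ℕ) : Module.End ℂ (Fin n → FormalField) where
  toFun w := FormalField.z⁻¹ • w
  map_add' v w := smul_add _ v w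
  map_smul' a w := smul_comm _ a w

theorem mulX_apply (w : Fin n → FormalField) : mulX n w = FormalField.z⁻¹ • w := rfl

theorem coordinateConnection_mul_mulX (c : Fin n → Fin n → FormalField) :
    coordinateConnection c * mulX n = mulX n * coordinateConnection c + 1 := by
  refine LinearMap.ext fun w => funext fun j => ?_
  simp only [Module.End.mul_apply, LinearMap.add_apply, coordinateConnection_apply, mulX_apply,
    Pi.add_apply, Pi.smul_apply, smul_eq_mul, FormalField.deriv_z_inv_mul, Finset.sum_apply,
    Module.End.one_apply, mul_add, Finset.mul_sum, mul_assoc]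
  ring

theorem aeval_mulX_apply (p : ℂ[X]) (w : Fin n → FormalField) :
    aeval (mulX n) p w = algebraMap ℂ[X] FormalField p • w := by
  rw [FormalField.algebraMap_def]
  induction p using Polynomial.induction_on generalizing w with
  | C a => simp
  | add p q hp hq => rw [map_add, map_add, LinearMap.add_apply, hp, hq, add_smul]
  | monomial i a ih =>
    rw [pow_succ, ← mul_assoc, map_mul _ (C a * X ^ i), map_mul _ (C a * X ^ i), aeval_X, aeval_X,
      Module.End.mul_apply, mulX_apply, ih, smul_smul]

/-- The action of the Weyl algebra on `Kⁿ` through `coordinateConnection`. -/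
def weylAction (c : Fin n → Fin n → FormalField) :
    WeylAlgebra →ₐ[ℂ] Module.End ℂ (Fin n → FormalField) :=
  WeylAlgebra.lift (mulX n) (coordinateConnection c) (coordinateConnection_mul_mulX c)

theorem weylAction_aeval_x (c : Fin n → Fin n → FormalField) (p : ℂ[X])
    (w : Fin n → FormalField) :
    weylAction c (aeval WeylAlgebra.x p) w = algebraMap ℂ[X] FormalField p • w := by
  rw [← aeval_algHom_apply, weylAction, WeylAlgebra.lift_x, aeval_mulX_apply]

theorem weylAction_aeval_d (c : Fin n → Fin n → FormalField) (p : ℂ[X])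
    (w : Fin n → FormalField) :
    weylAction c (aeval WeylAlgebra.d p) w =
      ∑ i ∈ Finset.range (p.natDegree + 1), p.coeff i • (coordinateConnection c)^[i] w := by
  rw [← aeval_algHom_apply, weylAction, WeylAlgebra.lift_d, aeval_eq_sum_range,
    LinearMap.sum_apply]
  simp only [LinearMap.smul_apply, Module.End.pow_apply]

/-- The rows of the companion matrix of `P(∂) + Q(x)`. -/
def companionRow (n : ℕ) (P Q : ℂ[X]) (hn : 0 < n) (i : Fin n) : Fin n → FormalField :=
  if h : (i : ℕ) + 1 < n then Pi.single ⟨i + 1, h⟩ 1 else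
    (P.coeff n)⁻¹ • -(∑ l : Fin n, P.coeff l • (Pi.single l 1 : Fin n → FormalField) +
      algebraMap ℂ[X] FormalField Q • (Pi.single ⟨0, hn⟩ 1 : Fin n → FormalField))

theorem coordinateConnection_companionRow_iterate (P Q : ℂ[X]) (hn : 0 < n) (i : ℕ) (hi : i < n) :
    (coordinateConnection (companionRow n P Q hn))^[i] (Pi.single ⟨0, hn⟩ 1) =
      Pi.single ⟨i, hi⟩ 1 := by
  induction i with
  | zero => rfl
  | succ i ih =>
    rw [Function.iterate_succ_apply', ih (by omega), coordinateConnection_single, companionRow,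
      dif_pos hi]

/-- The last companion row is chosen so that `∂^n e₀` satisfies the equation; hence `1 ↦ e₀`
descends to the Airy module. -/
theorem weylAction_airyOperator {P Q : ℂ[X]} (hn : 0 < n) (hP : P.natDegree = n) :
    weylAction (companionRow n P Q hn) (airyOperator P Q) (Pi.single ⟨0, hn⟩ 1) = 0 := by
  have hlc : P.coeff n ≠ 0 := by
    rw [← hP]
    exact leadingCoeff_ne_zero.2 (by rintro rfl; simp at hP; omega)
  rw [airyOperator, map_add, LinearMap.add_apply, weylAction_aeval_x, weylAction_aeval_d, hP,
    Finset.sum_range_succ, Finset.sum_range (fun i => P.coeff i •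
      (coordinateConnection (companionRow n P Q hn))^[i] (Pi.single ⟨0, hn⟩ 1))]
  have hlast : (coordinateConnection (companionRow n P Q hn))^[n] (Pi.single ⟨0, hn⟩ 1) =
      companionRow n P Q hn ⟨n - 1, by omega⟩ := by
    rw [← coordinateConnection_single (companionRow n P Q hn) ⟨n - 1, by omega⟩,
      ← coordinateConnection_companionRow_iterate P Q hn (n - 1) (by omega),
      ← Function.iterate_succ_apply' (coordinateConnection (companionRow n P Q hn)), Nat.succ_eq_add_one, Nat.sub_add_cancel hn]
  rw [hlast, companionRow, dif_neg (by simp; omega), smul_inv_smul₀ hlc]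
  simp only [fun i : Fin n => coordinateConnection_companionRow_iterate P Q hn i i.2]
  abel

end Companion

/-! ### The cyclic basis of a formalized Airy module -/

section AiryModule

/-- The class of `1` in the formalization of an Airy module. -/
def airyGenerator (P Q : ℂ[X]) : Formalization (AiryModule P Q) :=
  1 ⊗ₜ Submodule.Quotient.mk 1

theorem airyGenerator_annihilated (P Q : ℂ[X]) :
    evalConnection (connection (AiryModule P Q)) P (airyGenerator P Q) +
      algebraMap ℂ[X] FormalField Q • airyGenerator P Q = 0 := by
  have h : airyOperator P Q • (Submodule.Quotient.mk 1 : AiryModule P Q) = 0 := by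
    rw [← Submodule.Quotient.mk_smul, Submodule.Quotient.mk_eq_zero, smul_eq_mul, mul_one]
    exact Submodule.mem_span_singleton_self _
  rw [airyGenerator, evalConnection_one_tmul, algebraMap_smul_one_tmul, ← TensorProduct.tmul_add,
    ← add_smul]
  exact (congrArg _ h).trans (TensorProduct.tmul_zero _ _)

variable {n : ℕ} {P Q : ℂ[X]}

/-- The map to the companion module on `Kⁿ` induced by `1 ↦ e₀` carries these vectors to the
standard basis, so no normal form in the Weyl algebra is needed. -/
theorem linearIndependent_airyGenerator (hn : 0 < n) (hP : P.natDegree = n) :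
    LinearIndependent FormalField
      fun i : Fin n => (connection (AiryModule P Q))^[i] (airyGenerator P Q) := by
  let : Module WeylAlgebra (Fin n → FormalField) :=
    Module.compHom _ (weylAction (companionRow n P Q hn)).toRingHom
  have hsmul : ∀ (a : WeylAlgebra) (w : Fin n → FormalField),
      a • w = weylAction (companionRow n P Q hn) a w := fun _ _ => rfl
  let f : AiryModule P Q →ₗ[WeylAlgebra] (Fin n → FormalField) :=
    Submodule.liftQ _ (LinearMap.toSpanSingleton WeylAlgebra _ (Pi.single ⟨0, hn⟩ 1)) (by
      rw [Submodule.span_singleton_le_iff_mem, LinearMap.mem_ker, LinearMap.toSpanSingleton_apply,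
        hsmul, weylAction_airyOperator hn hP])
  let φ := liftFormalization (fun p w => weylAction_aeval_x (companionRow n P Q hn) p w) f
  refine LinearIndependent.of_comp φ ?_
  have h : (φ ∘ fun i : Fin n => (connection (AiryModule P Q))^[i] (airyGenerator P Q)) =
      fun i => Pi.basisFun FormalField (Fin n) i := by
    ext1 i
    have hf : f (Submodule.Quotient.mk 1) = Pi.single ⟨0, hn⟩ 1 :=
      one_smul WeylAlgebra (Pi.single ⟨0, hn⟩ 1 : Fin n → FormalField)
    rw [Function.comp_apply, airyGenerator, connection_iterate_one_tmul, liftFormalization_tmul,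
      one_smul, map_smul, hf, hsmul, map_pow, weylAction, WeylAlgebra.lift_d,
      Module.End.pow_apply, coordinateConnection_companionRow_iterate P Q hn i i.2,
      Pi.basisFun_apply]
  rw [h]
  exact (Pi.basisFun FormalField (Fin n)).linearIndependent

theorem span_airyGenerator (hn : 0 < n) (hP : P.natDegree = n) :
    ⊤ ≤ Submodule.span FormalField (Set.range
      fun i : Fin n => (connection (AiryModule P Q))^[i] (airyGenerator P Q)) := by
  set D := connection (AiryModule P Q) with hD
  set u := airyGenerator P Q with hu
  set S := Submodule.span FormalField (Set.range fun i : Fin n => D^[i] u) with hS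
  have hlc : P.coeff n ≠ 0 := by
    rw [← hP]
    exact leadingCoeff_ne_zero.2 (by rintro rfl; simp at hP; omega)
  have hmem : ∀ i < n, D^[i] u ∈ S := fun i hi => Submodule.subset_span ⟨⟨i, hi⟩, rfl⟩
  have hlast : D^[n] u ∈ S := by
    have h := airyGenerator_annihilated P Q
    rw [evalConnection, hP, Finset.sum_range_succ, add_assoc, add_comm, add_assoc,
      add_eq_zero_iff_eq_neg] at h
    have h' : algebraMap ℂ FormalField (P.coeff n) • D^[n] u ∈ S := by
      rw [h]
      refine S.neg_mem (S.add_mem (S.smul_mem _ (hmem 0 hn)) (S.sum_mem fun i hi => ?_))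
      exact S.smul_mem _ (hmem i (Finset.mem_range.1 hi))
    exact (S.smul_mem_iff (by simpa using hlc)).1 h'
  -- By the Leibniz rule, stability need only be checked on the generators, where the equation
  -- handles `∂^n u`.
  have hstable : ∀ w ∈ S, D w ∈ S := by
    intro w hw
    induction hw using Submodule.span_induction with
    | mem w hw =>
      obtain ⟨i, rfl⟩ := hw
      change D (D^[i] u) ∈ S
      rw [← Function.iterate_succ_apply' D]
      rcases Nat.lt_or_eq_of_le (Nat.succ_le_of_lt i.2) with h | h
      · exact hmem _ h
      · rw [h]
        exact hlast
    | zero => simp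
    | add v w _ _ hv hw =>
      rw [map_add]
      exact S.add_mem hv hw
    | smul f w hw' hw =>
      rw [hD, connection_smul]
      exact S.add_mem (S.smul_mem _ hw') (S.smul_mem _ hw)
  -- The condition `1 ⊗ v ∈ S` is preserved by constants, `x` and `∂`, hence by the whole Weyl
  -- algebra; applied to the class of 1, it reaches every `1 ⊗ v`.
  have hweyl : ∀ (a : WeylAlgebra) (v : AiryModule P Q), (1 ⊗ₜ v : Formalization _) ∈ S →
      (1 ⊗ₜ (a • v) : Formalization _) ∈ S := by
    intro a
    induction a using WeylAlgebra.induction_on with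
    | hC a =>
      intro v hv
      rw [← constant_smul_one_tmul]
      exact S.smul_mem _ hv
    | hx =>
      intro v hv
      have h := algebraMap_smul_one_tmul X v
      rw [aeval_X] at h
      rw [← h]
      exact S.smul_mem _ hv
    | hd =>
      intro v hv
      have h := connection_iterate_one_tmul 1 v
      rw [pow_one] at h
      rw [← h]
      exact hstable _ hv
    | hadd a b ha hb =>
      intro v hv
      rw [add_smul, TensorProduct.tmul_add]
      exact S.add_mem (ha v hv) (hb v hv)
    | hmul a b ha hb =>
      intro v hv
      rw [mul_smul]
      exact ha _ (hb v hv)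
  rintro w -
  induction w using TensorProduct.induction_on with
  | zero => exact S.zero_mem
  | tmul f v =>
    obtain ⟨a, rfl⟩ := Submodule.Quotient.mk_surjective _ v
    have h := hweyl a _ (hmem 0 hn)
    rw [← Submodule.Quotient.mk_smul, smul_eq_mul, mul_one] at h
    have h' := S.smul_mem f h
    rwa [TensorProduct.smul_tmul', smul_eq_mul, mul_one] at h'
  | add v w hv hw => exact S.add_mem hv hw

/-- The classes of `1, ∂, …, ∂ ^ (n - 1)` as a basis of the formalization of an Airy module. -/
def airyBasis (hn : 0 < n) (hP : P.natDegree = n) :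
    Module.Basis (Fin n) FormalField (Formalization (AiryModule P Q)) :=
  Module.Basis.mk (linearIndependent_airyGenerator hn hP) (span_airyGenerator hn hP)

theorem airyBasis_apply (hn : 0 < n) (hP : P.natDegree = n) (i : Fin n) :
    airyBasis (Q := Q) hn hP i = (connection (AiryModule P Q))^[i] (airyGenerator P Q) :=
  Module.Basis.mk_apply _ _ i

end AiryModule

/-! ### From gauge equivalence to isomorphism of connections -/

section Equivalence

variable {V₁ V₂ : Type*} [AddCommGroup V₁] [Module WeylAlgebra V₁] [AddCommGroup V₂]
  [Module WeylAlgebra V₂]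

theorem connection_basis {n : ℕ} (b : Module.Basis (Fin n) FormalField (Formalization V₁))
    (i : Fin n) : connection V₁ (b i) = ∑ j, systemMatrix b i j • b j :=
  (b.sum_repr _).symm

/-- A gauge equivalence of systems is an isomorphism of connections. -/
theorem FormallyEquivalent.exists_linearEquiv (h : FormallyEquivalent V₁ V₂) :
    ∃ φ : Formalization V₁ ≃ₗ[FormalField] Formalization V₂,
      ∀ w, φ (connection V₁ w) = connection V₂ (φ w) := by
  obtain ⟨n, b₁, b₂, P, hP⟩ := h
  have hgauge : P.val * systemMatrix b₂ + P.val.map FormalField.deriv =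
      systemMatrix b₁ * P.val := by
    have hPP : P.val * (P⁻¹).val = 1 := P.mul_inv
    rw [hP, mul_sub, ← mul_assoc, ← mul_assoc, ← mul_assoc, hPP, one_mul, one_mul, sub_add_cancel]
  -- Systems act on rows, so `φ` sends `b₁ i` to row `i` of `P` in the basis `b₂`; commuting with
  -- `∂` then reads `M₁ P = ∂P + P M₂`, which is `hgauge`.
  let φ : Formalization V₁ ≃ₗ[FormalField] Formalization V₂ :=
    b₁.equivFun ≪≫ₗ Matrix.toLinearEquivRight'OfInv (M := (P⁻¹).val) (M' := P.val)
      P.inv_mul P.mul_inv ≪≫ₗ b₂.equivFun.symm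
  have hφ : ∀ i, φ (b₁ i) = ∑ j, P.val i j • b₂ j := by
    intro i
    simp [φ, Module.Basis.equivFun_symm_apply, Matrix.toLinearEquivRight'OfInv,
      Finsupp.single_eq_pi_single]
  refine ⟨φ, fun w => ?_⟩
  rw [← b₁.sum_repr w]
  simp only [map_sum, connection_smul, map_add, map_smul]
  refine Finset.sum_congr rfl fun i _ => ?_
  congr 2
  rw [connection_basis, hφ]
  simp only [map_sum, connection_smul, map_smul, hφ, connection_basis b₂, Finset.smul_sum, smul_smul]
  rw [Finset.sum_add_distrib, Finset.sum_comm, Finset.sum_comm (f := fun j l =>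
    (P.val i j * systemMatrix b₂ j l) • b₂ l), ← Finset.sum_add_distrib]
  refine Finset.sum_congr rfl fun j _ => ?_
  rw [← Finset.sum_smul, ← Finset.sum_smul, ← add_smul]
  congr 1
  have hij := congrFun (congrFun hgauge i) j
  rw [Matrix.add_apply, Matrix.mul_apply, Matrix.mul_apply, Matrix.map_apply] at hij
  rw [← hij, add_comm]

theorem map_evalConnection {φ : Formalization V₁ ≃ₗ[FormalField] Formalization V₂}
    (hφ : ∀ w, φ (connection V₁ w) = connection V₂ (φ w)) (P : ℂ[X]) (u : Formalization V₁) :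
    φ (evalConnection (connection V₁) P u) = evalConnection (connection V₂) P (φ u) := by
  have hsc : Function.Semiconj φ (connection V₁) (connection V₂) := hφ
  simp only [evalConnection, map_sum, map_smul, (hsc.iterate_right _).eq]

end Equivalence

/-! ### Comparison of the bidegrees -/

theorem natDegree_le_of_linearEquiv {n : ℕ} {P₁ Q₁ P₂ Q₂ : ℂ[X]} (hn : 0 < n)
    (hP₁ : P₁.natDegree = n) (hP₂ : P₂.natDegree = n) (hQ₁ : Q₁ ≠ 0)
    (φ : Formalization (AiryModule P₁ Q₁) ≃ₗ[FormalField] Formalization (AiryModule P₂ Q₂))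
    (hφ : ∀ w, φ (connection _ w) = connection _ (φ w)) : Q₁.natDegree ≤ Q₂.natDegree := by
  have hB₁ := airyBasis_apply (Q := Q₁) hn hP₁ ⟨0, hn⟩
  have hB₂ := airyBasis_apply (Q := Q₂) hn hP₂ ⟨0, hn⟩
  rw [Function.iterate_zero_apply] at hB₁ hB₂
  -- The test vector is the image of the first generator: it is nonzero and still killed by `P₁(∂) +
  -- Q₁`, inside the second module.
  refine natDegree_le_of_annihilates (airyBasis (Q := Q₂) hn hP₂) connection_smul hn
    (fun i => by rw [hB₂, airyBasis_apply]) hP₂ (P₁ := P₁) (v := φ (airyGenerator P₁ Q₁)) ?_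
    hP₁ hQ₁ ?_ ?_
  · rw [hB₂]
    exact airyGenerator_annihilated P₂ Q₂
  · rw [← hB₁]
    exact φ.map_ne_zero_iff.2 ((airyBasis hn hP₁).ne_zero _)
  · rw [← map_evalConnection hφ, ← map_smul, ← map_add, airyGenerator_annihilated, map_zero]

end Airy
end

theorem proposition1p2p4 (n₁ m₁ n₂ m₂ : ℕ) (hn₁ : 1 ≤ n₁) (hn₂ : 1 ≤ n₂)
    (P₁ Q₁ P₂ Q₂ : Polynomial ℂ)
    (hP₁ : P₁.degree = (n₁ : WithBot ℕ)) (hQ₁ : Q₁.degree = (m₁ : WithBot ℕ))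
    (hP₂ : P₂.degree = (n₂ : WithBot ℕ)) (hQ₂ : Q₂.degree = (m₂ : WithBot ℕ))
    (h : Airy.FormallyEquivalent (Airy.AiryModule P₁ Q₁) (Airy.AiryModule P₂ Q₂)) :
    n₁ = n₂ ∧ m₁ = m₂ := by
  obtain ⟨φ, hφ⟩ := h.exists_linearEquiv
  have hP₁ := natDegree_eq_of_degree_eq_some hP₁
  have hP₂ := natDegree_eq_of_degree_eq_some hP₂
  have hQ₁' : Q₁ ≠ 0 := by rintro rfl; simp at hQ₁
  have hQ₂' : Q₂ ≠ 0 := by rintro rfl; simp at hQ₂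
  have hn : n₁ = n₂ := by
    have e := φ.finrank_eq
    rwa [Module.finrank_eq_card_basis (Airy.airyBasis hn₁ hP₁),
      Module.finrank_eq_card_basis (Airy.airyBasis hn₂ hP₂), Fintype.card_fin,
      Fintype.card_fin] at e
  subst hn
  have hφ' : ∀ w, φ.symm (Airy.connection _ w) = Airy.connection _ (φ.symm w) := fun w => by
    rw [LinearEquiv.symm_apply_eq, hφ, LinearEquiv.apply_symm_apply]
  rw [← natDegree_eq_of_degree_eq_some hQ₁, ← natDegree_eq_of_degree_eq_some hQ₂]
  exact ⟨rfl, le_antisymm (Airy.natDegree_le_of_linearEquiv hn₁ hP₁ hP₂ hQ₁' φ hφ)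
    (Airy.natDegree_le_of_linearEquiv hn₁ hP₂ hP₁ hQ₂' φ.symm hφ')⟩
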